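/- For a countable group $G$, let $\mathrm{LO}(G)$ be the space of left-orderings of $G$, each identified with its positive cone $P=\{g\in G : g>1\}$; thus $\mathrm{LO}(G)$ is the set of all $P\subseteq G$ such that $P\cdot P\subseteq P$ and $G$ is the disjoint union of $P$, $P^{-1}$ and $\{1\}$, with the topology of a subspace of the product space $2^{G}=\{0,1\}^G$ and the corresponding Borel structure. The group $G$ acts on $\mathrm{LO}(G)$ by conjugation, $g\cdot P=gPg^{-1}$. Let $\mathrm{LO}(G)/G$ be the set of orbits with the quotient Borel structure, in which a set of orbits is Borel if and only if its preimage in $\mathrm{LO}(G)$ is Borel. A measurable space is standard if its $\sigma$-algebra is the Borel $\sigma$-algebra of some Polish topology. **Proposition.** Let $\mathbb{F}_n$ be the free group on $n$ generators, and let $\mathbb{F}_\infty$ be the free group on countably infinitely many generators. If $n\geq 2$ is an integer or $n=\infty$, then $\mathrm{LO}(\mathbb{F}_n)/\mathbb{F}_n$ is not standard. -/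

import Mathlib

open scoped Pointwise

/-- The space `LO(G)` of left-orderings of a group `G`. A left-ordering `<` is given by its positive
cone `P = {g | 1 < g}`, that is, by a set `P` with `P * P ⊆ P` such that `G` is the disjoint union of
`P`, `P⁻¹` and `{1}`; the ordering is recovered by `g < h ↔ g⁻¹ * h ∈ P`. -/
@[ext]
structure LO (G : Type*) [Group G] where
  /-- The positive cone of the left-ordering. -/
  cone : Set G
  mul_subset : cone * cone ⊆ cone
  union_eq : cone ∪ cone⁻¹ ∪ {1} = Set.univ
  disjoint_inv : Disjoint cone cone⁻¹
  disjoint_one : Disjoint cone {1}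
  disjoint_inv_one : Disjoint cone⁻¹ {1}

namespace LO

variable {G : Type*} [Group G]

open Classical in
/-- The indicator function of the positive cone, as a point of `2 ^ G`. -/
noncomputable def indicator (P : LO G) : G → Bool := fun g => decide (g ∈ P.cone)

/-- The topology of `LO(G)` as a subspace of `2 ^ G`, the product of discrete two-point spaces. -/
noncomputable instance instTopologicalSpace : TopologicalSpace (LO G) :=
  TopologicalSpace.induced indicator inferInstance

/-- The Borel structure of `LO(G)`. -/
noncomputable instance instMeasurableSpace : MeasurableSpace (LO G) := borel (LO G)

instance instBorelSpace : BorelSpace (LO G) := ⟨rfl⟩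

/-- The left-ordering whose positive cone is `g P g⁻¹`. -/
def conj (g : G) (P : LO G) : LO G where
  cone := (fun x => g * x * g⁻¹) '' P.cone
  mul_subset := by
    rintro _ ⟨_, ⟨x, hx, rfl⟩, _, ⟨y, hy, rfl⟩, rfl⟩
    exact ⟨x * y, P.mul_subset (Set.mul_mem_mul hx hy), by simp [mul_assoc]⟩
  union_eq := by
    refine Set.eq_univ_of_forall fun x => ?_
    have h : g⁻¹ * x * g ∈ P.cone ∪ P.cone⁻¹ ∪ {1} := P.union_eq ▸ Set.mem_univ _
    rcases h with (h | h) | h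
    · exact Or.inl (Or.inl ⟨_, h, by simp [mul_assoc]⟩)
    · exact Or.inl (Or.inr ⟨_, h, by simp [mul_assoc]⟩)
    · refine Or.inr ?_
      have h' : g⁻¹ * x * g = 1 := h
      have : x = g * (g⁻¹ * x * g) * g⁻¹ := by simp [mul_assoc]
      rw [h'] at this
      simpa using this
  disjoint_inv := by
    refine Set.disjoint_left.2 ?_
    rintro _ ⟨x, hx, rfl⟩ ⟨y, hy, hxy⟩
    have h : x⁻¹ = y := by
      simpa [mul_assoc] using hxy.symm
    refine Set.disjoint_left.1 P.disjoint_inv hx ?_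
    rw [Set.mem_inv, h]
    exact hy
  disjoint_one := by
    refine Set.disjoint_left.2 ?_
    rintro _ ⟨x, hx, rfl⟩ h
    have h' : x = 1 := by simpa using h
    exact Set.disjoint_left.1 P.disjoint_one hx h'
  disjoint_inv_one := by
    refine Set.disjoint_left.2 ?_
    rintro z ⟨x, hx, hxz⟩ h
    have hz : z = 1 := h
    subst hz
    have h' : x = 1 := by simpa using hxz
    exact Set.disjoint_left.1 P.disjoint_one hx h'

/-- The conjugacy action of `G` on `LO(G)`. -/
instance instMulAction : MulAction G (LO G) where
  smul := conj
  one_smul P := by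
    change conj 1 P = P
    ext x
    simp [conj]
  mul_smul g h P := by
    change conj (g * h) P = conj g (conj h P)
    ext x
    simp [conj, mul_assoc]

end LO

/-- The quotient `LO(G)/G` of the space of left-orderings by the conjugacy action: the set of orbits. -/
def LOQuotient (G : Type*) [Group G] : Type _ :=
  Quotient (MulAction.orbitRel G (LO G))

/-- The quotient Borel structure on `LO(G)/G`: a set of orbits is Borel if and only if its preimage
in `LO(G)` is Borel. -/
noncomputable instance LOQuotient.instMeasurableSpace (G : Type*) [Group G] : MeasurableSpace (LOQuotient G) :=
  MeasurableSpace.map (Quotient.mk (MulAction.orbitRel G (LO G))) (borel (LO G))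

/-! A standard Borel space is countably separated, so it suffices to show that no countable family
of Borel sets separates conjugacy classes of orderings. This follows from embedding the shift on `ℤ
→ Bool` equivariantly into the conjugation action. A free group of rank at least two maps onto the
wreath product of `ℤ` by `ℤ`. A binary sequence `x` orders the wreath product: the quotient `ℤ`
dominates, and on the base group `x m` decides the sign when `m` is the last index of the support.
Conjugation by the generator of the quotient shifts `x`. The ordering is lifted to the free group
lexicographically, with the Magnus ordering on the kernel; as that one is conjugation invariant, the
lift stays equivariant (`freeGroupOrder_binaryShift`). The lift is also continuous and injective.
With a countably separated quotient, `x ↦` class of its ordering would be a Borel shift-invariant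
map, hence constant on a residual set by the zero-one law. But orbits are countable, so by
injectivity its fibres are countable, hence meager: a contradiction. -/

open Filter Topology

/-! ### Topological zero-one law and generic ergodicity -/

section BaireErgodicity

variable {X : Type*} [TopologicalSpace X]

/-- Topological zero-one law: under a topologically transitive open continuous map, an invariant set
with the Baire property is residual or meager. -/
theorem BaireMeasurableSet.eventually_mem_or_notMem {T : X → X} (hT : Continuous T)
    (hT' : IsOpenMap T)
    (htrans : ∀ U V : Set X, IsOpen U → IsOpen V → U.Nonempty → V.Nonempty →
      ∃ n : ℕ, (T^[n] ⁻¹' U ∩ V).Nonempty)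
    {s : Set X} (hs : BaireMeasurableSet s) (hinv : T ⁻¹' s = s) :
    (∀ᶠ x in residual X, x ∈ s) ∨ ∀ᶠ x in residual X, x ∉ s := by
  obtain ⟨U, hU, hsU⟩ := hs.residualEq_isOpen
  rcases U.eq_empty_or_nonempty with rfl | hne
  · right
    filter_upwards [hsU.mem_iff] with x hx
    simpa using hx
  left
  have hiter (n : ℕ) : T^[n] ⁻¹' s = s := by
    induction n with
    | zero => rfl
    | succ n ih => rw [Function.iterate_succ', Set.preimage_comp, hinv, ih]
  have hopen : IsOpen (⋃ n : ℕ, T^[n] ⁻¹' U) :=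
    isOpen_iUnion fun n => hU.preimage (hT.iterate n)
  have hdense : Dense (⋃ n : ℕ, T^[n] ⁻¹' U) := by
    refine dense_iff_inter_open.2 fun V hV hVne => ?_
    obtain ⟨n, x, hx, hxV⟩ := htrans U V hU hV hne hVne
    exact ⟨x, hxV, Set.mem_iUnion.2 ⟨n, hx⟩⟩
  have hiterOpen (n : ℕ) : IsOpenMap T^[n] := by
    induction n with
    | zero => exact IsOpenMap.id
    | succ n ih => exact Function.iterate_succ T n ▸ ih.comp hT'
  -- Preimages of residual sets under continuous open maps are residual, so a generic orbit never
  -- meets the meager difference of `s` and `U`.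
  have hall : ∀ᶠ x in residual X, ∀ n : ℕ, T^[n] x ∈ s ↔ T^[n] x ∈ U :=
    eventually_countable_forall.2 fun n =>
      (tendsto_residual_of_isOpenMap (hT.iterate n) (hiterOpen n)).eventually hsU.mem_iff
  filter_upwards [hall, residual_of_dense_open hopen hdense] with x hx hxU
  obtain ⟨n, hn⟩ := Set.mem_iUnion.1 hxU
  rw [← hiter n]
  exact (hx n).2 hn

/-- A measurable invariant map of a topologically transitive system without isolated points into a
countably separated space has an uncountable fibre. -/
theorem exists_fiber_not_countable [BaireSpace X] [T1Space X] [Nonempty X]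
    [∀ x : X, NeBot (𝓝[≠] x)] [MeasurableSpace X] [BorelSpace X]
    {Y : Type*} [MeasurableSpace Y] [MeasurableSpace.CountablySeparated Y]
    {T : X → X} (hT : Continuous T) (hT' : IsOpenMap T)
    (htrans : ∀ U V : Set X, IsOpen U → IsOpen V → U.Nonempty → V.Nonempty →
      ∃ n : ℕ, (T^[n] ⁻¹' U ∩ V).Nonempty)
    {q : X → Y} (hq : Measurable q) (hqT : ∀ x, q (T x) = q x) :
    ∃ y, ¬ (q ⁻¹' {y}).Countable := by
  have : Nonempty Y := ⟨q (Classical.arbitrary X)⟩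
  obtain ⟨y, hy⟩ := exists_eventuallyEq_const_of_forall_separating (l := residual X) (f := q)
    MeasurableSet fun U hU => (hq hU).baireMeasurableSet.eventually_mem_or_notMem hT hT' htrans
      (by ext x; simp [hqT])
  refine ⟨y, fun hc => ?_⟩
  have h1 : ∀ᶠ x in residual X, ∀ c ∈ q ⁻¹' {y}, x ≠ c :=
    (eventually_countable_ball hc).2 fun c _ =>
      residual_of_dense_open isOpen_compl_singleton (dense_compl_singleton c)
  have h2 : ∀ᶠ _ in residual X, False := by
    filter_upwards [hy, h1] with x hx hx'
    exact hx' x hx rfl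
  exact (dense_of_mem_residual h2).nonempty.elim fun _ h => h

end BaireErgodicity

/-! ### The two-sided binary shift -/

section Shift

/-- The shift of `2 ^ ℤ`. -/
def binaryShift : (ℤ → Bool) ≃ₜ (ℤ → Bool) where
  toFun x n := x (n - 1)
  invFun x n := x (n + 1)
  left_inv x := by ext n; simp
  right_inv x := by ext n; simp

theorem binaryShift_iterate_apply (n : ℕ) (x : ℤ → Bool) (j : ℤ) :
    binaryShift^[n] x j = x (j - n) := by
  induction n generalizing j with
  | zero => simp
  | succ n ih =>
    rw [Function.iterate_succ_apply']
    change binaryShift^[n] x (j - 1) = _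
    rw [ih]
    congr 1
    push_cast
    ring

theorem binaryShift_transitive (U V : Set (ℤ → Bool)) (hU : IsOpen U) (hV : IsOpen V)
    (hUne : U.Nonempty) (hVne : V.Nonempty) :
    ∃ n : ℕ, (binaryShift^[n] ⁻¹' U ∩ V).Nonempty := by
  obtain ⟨u, hu⟩ := hUne
  obtain ⟨v, hv⟩ := hVne
  -- `z n` copies `v` on `[-n, ∞)` and a translate of `u` further left; shifting by `2 * n` moves
  -- that translate back onto `u` at all coordinates below `n`.
  let z : ℕ → ℤ → Bool := fun n j => if -(n : ℤ) ≤ j then v j else u (j + (2 * n : ℕ))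
  have hz : Tendsto z atTop (𝓝 v) := by
    refine tendsto_pi_nhds.2 fun j => tendsto_nhds_of_eventually_eq ?_
    filter_upwards [eventually_ge_atTop j.natAbs] with n hn
    exact if_pos (by omega)
  have hz' : Tendsto (fun n => binaryShift^[2 * n] (z n)) atTop (𝓝 u) := by
    refine tendsto_pi_nhds.2 fun j => tendsto_nhds_of_eventually_eq ?_
    filter_upwards [eventually_gt_atTop j.natAbs] with n hn
    rw [binaryShift_iterate_apply]
    have : ¬ -(n : ℤ) ≤ j - (2 * n : ℕ) := by omega
    simp only [z, if_neg this, sub_add_cancel]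
  obtain ⟨n, hn, hn'⟩ :=
    ((hz.eventually (hV.mem_nhds hv)).and (hz'.eventually (hU.mem_nhds hu))).exists
  exact ⟨2 * n, z n, hn', hn⟩

instance neBot_nhdsNE_binarySequence (x : ℤ → Bool) : NeBot (𝓝[≠] x) := by
  refine mem_closure_iff_nhdsWithin_neBot.1 (mem_closure_of_tendsto
    (f := fun n : ℕ => Function.update x n (!x n)) (b := atTop) ?_ (Eventually.of_forall ?_))
  · refine tendsto_pi_nhds.2 fun j => tendsto_nhds_of_eventually_eq ?_
    filter_upwards [eventually_gt_atTop j.natAbs] with n hn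
    exact Function.update_of_ne (by omega) _ _
  · intro n h
    have := congrFun h n
    simp at this

end Shift

/-! ### Noncommutative power series -/

section Series

variable {ι : Type*}

/-- The power series `1`. -/
def seriesOne : List ι → ℤ
  | [] => 1
  | _ :: _ => 0

/-- The product of formal power series in noncommuting variables. -/
def seriesMul : (List ι → ℤ) → (List ι → ℤ) → List ι → ℤ
  | e, f, [] => e [] * f []
  | e, f, x :: w => e [] * f (x :: w) + seriesMul (fun u => e (x :: u)) f w

theorem zero_seriesMul (f : List ι → ℤ) (w : List ι) : seriesMul (fun _ => 0) f w = 0 := by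
  induction w with
  | nil => simp [seriesMul]
  | cons x w ih => simp [seriesMul, ih]

theorem add_seriesMul (e e' f : List ι → ℤ) (w : List ι) :
    seriesMul (fun u => e u + e' u) f w = seriesMul e f w + seriesMul e' f w := by
  induction w generalizing e e' with
  | nil => simp only [seriesMul]; ring
  | cons x w ih => simp only [seriesMul, ih]; ring

theorem one_seriesMul (f : List ι → ℤ) : seriesMul seriesOne f = f := by
  funext w
  cases w with
  | nil => simp [seriesMul, seriesOne]
  | cons x w => simp [seriesMul, seriesOne, zero_seriesMul]

theorem seriesMul_apply_of_left {e : List ι → ℤ} (f : List ι → ℤ) {w : List ι}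
    (h : ∀ u, u.length < w.length → e u = 0) : seriesMul e f w = e w * f [] := by
  induction w generalizing e with
  | nil => rfl
  | cons x w ih =>
    rw [seriesMul, h [] (by simp), ih fun u hu => h _ (by simpa using hu)]
    ring

theorem seriesMul_apply_of_right (e : List ι → ℤ) {f : List ι → ℤ} {w : List ι}
    (h : ∀ u, u ≠ [] → u.length ≤ w.length → f u = 0) : seriesMul e f w = e w * f [] := by
  induction w generalizing e with
  | nil => rfl
  | cons x w ih =>
    rw [seriesMul, h (x :: w) (by simp) le_rfl, ih _ fun u hu hu' => h u hu (hu'.trans (by simp))]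
    ring

end Series

/-! ### Length-first order of monomials -/

section WordKey

variable {ι : Type*} [Encodable ι]

/-- The length-first well-order of words. -/
def wordKey (w : List ι) : ℕ ×ₗ ℕ := toLex (w.length, Encodable.encode w)

theorem wordKey_injective : Function.Injective (wordKey : List ι → ℕ ×ₗ ℕ) := fun u v h => by
  have : (u.length, Encodable.encode u) = (v.length, Encodable.encode v) := toLex.injective h
  exact Encodable.encode_injective (Prod.ext_iff.1 this).2

theorem wordKey_lt_of_length_lt {u v : List ι} (h : u.length < v.length) :
    wordKey u < wordKey v :=
  Prod.Lex.toLex_lt_toLex.2 (Or.inl h)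

theorem length_le_of_wordKey_le {u v : List ι} (h : wordKey u ≤ wordKey v) :
    u.length ≤ v.length :=
  le_of_not_gt fun h' => (wordKey_lt_of_length_lt h').not_ge h

end WordKey

/-! ### The Magnus expansion and its bi-ordering -/

section Magnus

variable {ι : Type*} [DecidableEq ι]

/-- Left multiplication by `1 + a` on formal power series in noncommuting variables. -/
def letterMul (a : ι) (f : List ι → ℤ) : List ι → ℤ
  | [] => f []
  | x :: w => f (x :: w) + if x = a then f w else 0

/-- Left multiplication by `(1 + a)⁻¹` on formal power series in noncommuting variables. -/
def letterDiv (a : ι) (f : List ι → ℤ) : List ι → ℤ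
  | [] => f []
  | x :: w => f (x :: w) - if x = a then letterDiv a f w else 0

theorem letterDiv_letterMul (a : ι) (f : List ι → ℤ) : letterDiv a (letterMul a f) = f := by
  funext w
  induction w with
  | nil => rfl
  | cons x w ih => simp only [letterDiv, letterMul, ih]; ring

theorem letterMul_letterDiv (a : ι) (f : List ι → ℤ) : letterMul a (letterDiv a f) = f := by
  funext w
  cases w with
  | nil => rfl
  | cons x w => simp only [letterDiv, letterMul]; ring

/-- Multiplication by `1 + a` as a permutation of the formal power series. -/
def letterPerm (a : ι) : Equiv.Perm (List ι → ℤ) where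
  toFun := letterMul a
  invFun := letterDiv a
  left_inv := letterDiv_letterMul a
  right_inv := letterMul_letterDiv a

/-- The action of the free group on formal power series in which `a` multiplies by `1 + a`. -/
def magnusAction : FreeGroup ι →* Equiv.Perm (List ι → ℤ) := FreeGroup.lift letterPerm

/-- The Magnus expansion of an element of the free group. -/
def magnus (g : FreeGroup ι) : List ι → ℤ := magnusAction g seriesOne

theorem letterMul_seriesMul (a : ι) (e f : List ι → ℤ) :
    letterMul a (seriesMul e f) = seriesMul (letterMul a e) f := by
  funext w
  cases w with
  | nil => rfl
  | cons x w =>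
    simp only [letterMul, seriesMul, add_seriesMul]
    split_ifs
    · ring
    · rw [zero_seriesMul]; ring

theorem magnusAction_seriesMul (g : FreeGroup ι) (e f : List ι → ℤ) :
    magnusAction g (seriesMul e f) = seriesMul (magnusAction g e) f := by
  induction g using FreeGroup.induction_on generalizing e with
  | C1 => simp
  | of a =>
    simp only [magnusAction, FreeGroup.lift_apply_of]
    exact letterMul_seriesMul a e f
  | inv_of a _ =>
    simp only [magnusAction, map_inv, FreeGroup.lift_apply_of, Equiv.Perm.inv_def]
    rw [Equiv.symm_apply_eq]
    change _ = letterMul a _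
    rw [letterMul_seriesMul]
    exact congrArg (seriesMul · f) (letterMul_letterDiv a e).symm
  | mul g h hg hh => rw [map_mul, Equiv.Perm.mul_apply, Equiv.Perm.mul_apply, hh, hg]

theorem magnus_mul (g h : FreeGroup ι) : magnus (g * h) = seriesMul (magnus g) (magnus h) := by
  rw [magnus, map_mul, Equiv.Perm.mul_apply, magnus, ← magnusAction_seriesMul, one_seriesMul]
  rfl

@[simp]
theorem magnus_one : magnus (1 : FreeGroup ι) = seriesOne := by simp [magnus]

@[simp]
theorem magnus_nil (g : FreeGroup ι) : magnus g [] = 1 := by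
  have key (g : FreeGroup ι) (f : List ι → ℤ) : magnusAction g f [] = f [] := by
    induction g using FreeGroup.induction_on generalizing f with
    | C1 => simp
    | of a => simp [magnusAction, letterPerm, letterMul]
    | inv_of a _ => simp [magnusAction, letterPerm, letterDiv, Equiv.Perm.inv_def]
    | mul g h hg hh => rw [map_mul, Equiv.Perm.mul_apply, hg, hh]
  exact key g _

/-- The Magnus expansion of `g` has no nonconstant terms of degree less than `n`. -/
def MagnusVanishes (g : FreeGroup ι) (n : ℕ) : Prop :=
  ∀ u : List ι, u ≠ [] → u.length < n → magnus g u = 0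

/-- In `(1 + α)(1 + β) = 1 + α + β + αβ`, the cross term at `w` needs a nonempty proper prefix of
`w` in `α`, and there are no such terms. -/
theorem magnus_mul_apply_of_left {g : FreeGroup ι} (h : FreeGroup ι) {w : List ι} (hw : w ≠ [])
    (hg : MagnusVanishes g w.length) : magnus (g * h) w = magnus g w + magnus h w := by
  obtain ⟨x, w, rfl⟩ := List.exists_cons_of_ne_nil hw
  rw [magnus_mul, seriesMul, magnus_nil,
    seriesMul_apply_of_left _ fun u hu => hg _ (by simp) (by simpa using hu), magnus_nil]
  ring

theorem magnus_mul_apply_of_right (g : FreeGroup ι) {h : FreeGroup ι} {w : List ι} (hw : w ≠ [])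
    (hh : MagnusVanishes h w.length) : magnus (g * h) w = magnus g w + magnus h w := by
  obtain ⟨x, w, rfl⟩ := List.exists_cons_of_ne_nil hw
  rw [magnus_mul, seriesMul, magnus_nil,
    seriesMul_apply_of_right _ fun u hu hu' => hh _ hu (by simpa [Nat.lt_succ_iff] using hu'),
    magnus_nil]
  ring

theorem MagnusVanishes.mono {g : FreeGroup ι} {m n : ℕ} (hg : MagnusVanishes g n) (h : m ≤ n) :
    MagnusVanishes g m :=
  fun u hu hu' => hg u hu (hu'.trans_le h)

theorem magnus_inv_apply {g : FreeGroup ι} {n : ℕ} (hg : MagnusVanishes g n) {w : List ι}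
    (hw : w ≠ []) (hn : w.length ≤ n) : magnus g⁻¹ w = -magnus g w := by
  have h := magnus_mul_apply_of_left g⁻¹ hw (hg.mono hn)
  obtain ⟨x, w, rfl⟩ := List.exists_cons_of_ne_nil hw
  rw [mul_inv_cancel, magnus_one, seriesOne] at h
  linarith

/-- Both sides of `(g * h * g⁻¹) * g = g * h` are additive at `w`, so the contribution of `g`
cancels. Induction on length supplies the vanishing of the conjugate in lower degrees. -/
theorem magnus_conj_apply (g : FreeGroup ι) {h : FreeGroup ι} {n : ℕ} (hh : MagnusVanishes h n)
    {w : List ι} (hw : w ≠ []) (hn : w.length ≤ n) : magnus (g * h * g⁻¹) w = magnus h w := by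
  induction hl : w.length using Nat.strong_induction_on generalizing w with
  | _ l ih =>
    have hv : MagnusVanishes (g * h * g⁻¹) w.length := fun u hu hu' => by
      rw [ih _ (hl ▸ hu') hu (hu'.le.trans hn) rfl]
      exact hh u hu (hu'.trans_le hn)
    have h1 := magnus_mul_apply_of_left g hw hv
    rw [inv_mul_cancel_right, magnus_mul_apply_of_right g hw (hh.mono hn)] at h1
    linarith

/-- The sign `1` for `true` and `-1` for `false`. -/
def boolSign (b : Bool) : ℤ := if b then 1 else -1

theorem letterPerm_cond_apply (a x : ι) (b : Bool) (f : List ι → ℤ) (w : List ι) (h : x ≠ a) :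
    (cond b (letterPerm a) (letterPerm a)⁻¹) f (x :: w) = f (x :: w) := by
  cases b <;> simp [letterPerm, letterMul, letterDiv, Equiv.Perm.inv_def, h]

theorem letterPerm_cond_apply_of_head? {a : ι} (b : Bool) (f : List ι → ℤ) {w : List ι}
    (h : w.head? ≠ some a) : (cond b (letterPerm a) (letterPerm a)⁻¹) f w = f w := by
  cases w with
  | nil => cases b <;> simp [letterPerm, letterMul, letterDiv, Equiv.Perm.inv_def]
  | cons x w => exact letterPerm_cond_apply a x b f w (by simpa using h)

theorem letterPerm_cond_apply_cons {a : ι} (b : Bool) (f : List ι → ℤ) {w : List ι}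
    (h : w.head? ≠ some a) :
    (cond b (letterPerm a) (letterPerm a)⁻¹) f (a :: w) = f (a :: w) + boolSign b * f w := by
  cases b
  · have := letterPerm_cond_apply_of_head? false f h
    simp only [cond_false, letterPerm, Equiv.Perm.inv_def, Equiv.coe_fn_symm_mk] at this ⊢
    simp [letterDiv, boolSign, this]
    ring
  · simp [letterPerm, letterMul, boolSign]

theorem letterPerm_cond_apply_eq_zero (a : ι) (b : Bool) {f : List ι → ℤ} {x : ι} {v : List ι}
    (h : ∀ u, f (u ++ x :: v) = 0) (hx : x ≠ a) (u : List ι) :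
    (cond b (letterPerm a) (letterPerm a)⁻¹) f (u ++ x :: v) = 0 := by
  induction u with
  | nil => rw [List.nil_append, letterPerm_cond_apply _ _ _ _ _ hx]; exact h []
  | cons y u ih =>
    cases b
    · simp only [cond_false, letterPerm, Equiv.Perm.inv_def, Equiv.coe_fn_symm_mk] at ih ⊢
      have := h (y :: u)
      simp only [List.cons_append] at this ⊢
      simp [letterDiv, this, ih]
    · have h1 := h (y :: u)
      have h2 := h u
      simp only [List.cons_append] at h1 ⊢
      simp [letterPerm, letterMul, h1, h2]

/-- In the expansion of a reduced word, the coefficient of the word that takes one letter of each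
syllable does not vanish. -/
theorem exists_magnusAction_mk_ne_zero (a : ι) (b : Bool) (L : List (ι × Bool))
    (hL : FreeGroup.IsReduced ((a, b) :: L)) :
    ∃ (v : List ι) (k : ℤ), v.head? ≠ some a ∧ 0 < boolSign b * k ∧
      magnus (FreeGroup.mk ((a, b) :: L)) v ≠ 0 ∧
      magnus (FreeGroup.mk ((a, b) :: L)) (a :: v) =
        k * magnus (FreeGroup.mk ((a, b) :: L)) v ∧
      ∀ x, x ≠ a → ∀ u, magnus (FreeGroup.mk ((a, b) :: L)) (u ++ x :: a :: v) = 0 := by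
  have hstep (c : ι) (d : Bool) (M : List (ι × Bool)) : magnus (FreeGroup.mk ((c, d) :: M)) =
      (cond d (letterPerm c) (letterPerm c)⁻¹) (magnus (FreeGroup.mk M)) := by
    simp [magnus, magnusAction, FreeGroup.lift_mk, Equiv.Perm.mul_apply]
  have hsign (d : Bool) : boolSign d * boolSign d = 1 := by cases d <;> rfl
  -- Here `k` is the signed exponent of the first syllable, and `v` takes one letter from each later
  -- syllable. The last clause lets a new syllable be prepended: it says that no monomial ending in
  -- `a :: v` has another letter just before that suffix.
  induction L generalizing a b with
  | nil =>
    have h1 : magnus (FreeGroup.mk ([] : List (ι × Bool))) = seriesOne := magnus_one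
    have hz : ∀ x, x ≠ a → ∀ u, magnus (FreeGroup.mk [(a, b)]) (u ++ x :: a :: []) = 0 := by
      intro x hx
      rw [hstep, h1]
      exact letterPerm_cond_apply_eq_zero a b (fun u => by cases u <;> rfl) hx
    refine ⟨[], boolSign b, by simp, by rw [hsign]; exact one_pos, by simp, ?_, hz⟩
    rw [hstep, h1, letterPerm_cond_apply_cons b _ (by simp),
      letterPerm_cond_apply_of_head? b _ (by simp)]
    simp [seriesOne]
  | cons p L ih =>
    obtain ⟨c, d⟩ := p
    rw [FreeGroup.IsReduced, List.isChain_cons_cons] at hL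
    obtain ⟨v, k, hv, hk, hne, hcons, hz⟩ := ih c d hL.2
    rw [hstep a b]
    set f := magnus (FreeGroup.mk ((c, d) :: L))
    have hk0 : k ≠ 0 := by rintro rfl; simp at hk
    by_cases hac : a = c
    · subst hac
      -- Reducedness forces equal signs, so the exponent grows in absolute value and cannot cancel.
      obtain rfl : b = d := hL.1 rfl
      refine ⟨v, k + boolSign b, hv, ?_, ?_, ?_, fun x hx => ?_⟩
      · rw [mul_add, hsign]; linarith
      · rwa [letterPerm_cond_apply_of_head? b _ hv]
      · rw [letterPerm_cond_apply_of_head? b _ hv, letterPerm_cond_apply_cons b _ hv, hcons]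
        ring
      · exact letterPerm_cond_apply_eq_zero a b (hz x hx) hx
    · have hv' : (c :: v).head? ≠ some a := by simpa using fun h => hac h.symm
      refine ⟨c :: v, boolSign b, hv', by rw [hsign]; exact one_pos, ?_, ?_, fun x hx => ?_⟩
      · rw [letterPerm_cond_apply_of_head? b _ hv', hcons]
        exact mul_ne_zero hk0 hne
      · rw [letterPerm_cond_apply_of_head? b _ hv', letterPerm_cond_apply_cons b _ hv',
          show f (a :: c :: v) = 0 from hz a hac []]
        ring
      · refine letterPerm_cond_apply_eq_zero a b (fun u => ?_) hx
        simpa using hz a hac (u ++ [x])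

/-- The Magnus expansion is faithful. -/
theorem exists_magnus_ne_zero {g : FreeGroup ι} (hg : g ≠ 1) : ∃ w, w ≠ [] ∧ magnus g w ≠ 0 := by
  have hred : FreeGroup.IsReduced g.toWord := FreeGroup.isReduced_toWord
  rw [← FreeGroup.mk_toWord (x := g)]
  cases hL : g.toWord with
  | nil => exact absurd (FreeGroup.toWord_eq_nil_iff.1 hL) hg
  | cons p L =>
    obtain ⟨v, k, -, hk, hne, hcons, -⟩ := exists_magnusAction_mk_ne_zero p.1 p.2 L (hL ▸ hred)
    refine ⟨p.1 :: v, by simp, ?_⟩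
    rw [show p = (p.1, p.2) from rfl, hcons]
    exact mul_ne_zero (by rintro rfl; simp at hk) hne

variable [Encodable ι]

/-- The Magnus expansion of `g` has no nonconstant terms before the monomial `w`. -/
def MagnusVanishesBelow (g : FreeGroup ι) (w : List ι) : Prop :=
  ∀ u : List ι, u ≠ [] → wordKey u < wordKey w → magnus g u = 0

theorem MagnusVanishesBelow.vanishes {g : FreeGroup ι} {w : List ι}
    (h : MagnusVanishesBelow g w) : MagnusVanishes g w.length :=
  fun u hu hu' => h u hu (wordKey_lt_of_length_lt hu')

/-- The first nonconstant coefficient of the Magnus expansion of `g` is positive. -/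
def MagnusPos (g : FreeGroup ι) : Prop :=
  ∃ w, w ≠ [] ∧ 0 < magnus g w ∧ MagnusVanishesBelow g w

theorem not_magnusPos_one : ¬ MagnusPos (1 : FreeGroup ι) := by
  rintro ⟨w, hw, h, -⟩
  obtain ⟨x, w, rfl⟩ := List.exists_cons_of_ne_nil hw
  simp [seriesOne] at h

/-- Up to the earlier of the two leading monomials, coefficients of the product add, since cross
terms would require lower degree. -/
theorem MagnusPos.mul {g h : FreeGroup ι} (hg : MagnusPos g) (hh : MagnusPos h) :
    MagnusPos (g * h) := by
  obtain ⟨w, hw, hgw, hgz⟩ := hg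
  obtain ⟨v, hv, hhv, hhz⟩ := hh
  rcases lt_trichotomy (wordKey w) (wordKey v) with hlt | heq | hlt
  · refine ⟨w, hw, ?_, fun u hu huw => ?_⟩
    · rw [magnus_mul_apply_of_left h hw hgz.vanishes, hhz w hw hlt, add_zero]
      exact hgw
    · rw [magnus_mul_apply_of_left h hu (hgz.vanishes.mono (length_le_of_wordKey_le huw.le)),
        hgz u hu huw, hhz u hu (huw.trans hlt), add_zero]
  · obtain rfl := wordKey_injective heq
    refine ⟨w, hw, ?_, fun u hu huw => ?_⟩
    · rw [magnus_mul_apply_of_left h hw hgz.vanishes]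
      exact add_pos hgw hhv
    · rw [magnus_mul_apply_of_left h hu (hgz.vanishes.mono (length_le_of_wordKey_le huw.le)),
        hgz u hu huw, hhz u hu huw, add_zero]
  · refine ⟨v, hv, ?_, fun u hu huv => ?_⟩
    · rw [magnus_mul_apply_of_right g hv hhz.vanishes, hgz v hv hlt, zero_add]
      exact hhv
    · rw [magnus_mul_apply_of_right g hu (hhz.vanishes.mono (length_le_of_wordKey_le huv.le)),
        hhz u hu huv, hgz u hu (huv.trans hlt), add_zero]

theorem magnusPos_or_inv {g : FreeGroup ι} (hg : g ≠ 1) : MagnusPos g ∨ MagnusPos g⁻¹ := by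
  obtain ⟨w, ⟨hw, hgw⟩, hmin⟩ :=
    (InvImage.wf (wordKey : List ι → ℕ ×ₗ ℕ) wellFounded_lt).has_min
      {w | w ≠ [] ∧ magnus g w ≠ 0} (exists_magnus_ne_zero hg)
  have hz : MagnusVanishesBelow g w := fun u hu huw => by
    by_contra h
    exact hmin u ⟨hu, h⟩ huw
  rcases hgw.lt_or_gt with h | h
  · refine Or.inr ⟨w, hw, ?_, fun u hu huw => ?_⟩
    · rw [magnus_inv_apply hz.vanishes hw le_rfl]
      linarith
    · rw [magnus_inv_apply hz.vanishes hu (length_le_of_wordKey_le huw.le), hz u hu huw, neg_zero]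
  · exact Or.inl ⟨w, hw, h, hz⟩

theorem MagnusPos.conj {h : FreeGroup ι} (hh : MagnusPos h) (g : FreeGroup ι) :
    MagnusPos (g * h * g⁻¹) := by
  obtain ⟨w, hw, hpos, hz⟩ := hh
  refine ⟨w, hw, ?_, fun u hu huw => ?_⟩
  · rwa [magnus_conj_apply g hz.vanishes hw le_rfl]
  · rw [magnus_conj_apply g hz.vanishes hu (length_le_of_wordKey_le huw.le), hz u hu huw]

end Magnus

/-! ### Lexicographic left-orderings -/

section LeftOrders

namespace LO

variable {G H : Type*} [Group G] [Group H]

theorem one_notMem_cone (P : LO G) : (1 : G) ∉ P.cone :=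
  fun h => Set.disjoint_left.1 P.disjoint_one h rfl

theorem mul_mem_cone (P : LO G) {g h : G} (hg : g ∈ P.cone) (hh : h ∈ P.cone) : g * h ∈ P.cone :=
  P.mul_subset (Set.mul_mem_mul hg hh)

theorem mem_cone_or_inv_mem (P : LO G) {g : G} (hg : g ≠ 1) : g ∈ P.cone ∨ g⁻¹ ∈ P.cone := by
  have h : g ∈ P.cone ∪ P.cone⁻¹ ∪ {1} := P.union_eq ▸ Set.mem_univ _
  exact h.resolve_right hg

theorem mem_smul_cone (g : G) (P : LO G) (h : G) : h ∈ (g • P).cone ↔ g⁻¹ * h * g ∈ P.cone := by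
  constructor
  · rintro ⟨k, hk, rfl⟩
    simpa [mul_assoc] using hk
  · exact fun hk => ⟨_, hk, by simp [mul_assoc]⟩

/-- The left-ordering with a given predicate of positivity. -/
def ofPos (p : G → Prop) (hmul : ∀ g h, p g → p h → p (g * h)) (hone : ¬ p 1)
    (htotal : ∀ g, g ≠ 1 → p g ∨ p g⁻¹) : LO G where
  cone := {g | p g}
  mul_subset := by
    rintro _ ⟨g, hg, h, hh, rfl⟩
    exact hmul g h hg hh
  union_eq := by
    refine Set.eq_univ_of_forall fun g => ?_
    by_cases hg : g = 1
    · exact Or.inr hg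
    · exact Or.inl (htotal g hg)
  disjoint_inv := Set.disjoint_left.2 fun g hg hg' => hone (by simpa using hmul _ _ hg hg')
  disjoint_one := Set.disjoint_left.2 fun g hg hg' => hone (hg' ▸ hg)
  disjoint_inv_one := Set.disjoint_left.2 fun g hg hg' => by
    obtain rfl : g = 1 := hg'
    exact hone (by simpa using hg)

/-- The lexicographic left-ordering: elements are compared first by their images under `φ` in the
ordering `Q`, then in the ordering `P`. -/
def lex (φ : G →* H) (Q : LO H) (P : LO G) : LO G :=
  ofPos (fun g => φ g ∈ Q.cone ∨ φ g = 1 ∧ g ∈ P.cone)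
    (by
      rintro g h (hg | ⟨hg, hg'⟩) (hh | ⟨hh, hh'⟩) <;> rw [map_mul]
      · exact Or.inl (Q.mul_mem_cone hg hh)
      · exact Or.inl (by rwa [hh, mul_one])
      · exact Or.inl (by rwa [hg, one_mul])
      · exact Or.inr ⟨by rw [hg, hh, mul_one], P.mul_mem_cone hg' hh'⟩)
    (by
      rintro (h | ⟨-, h⟩)
      · exact Q.one_notMem_cone (map_one φ ▸ h)
      · exact P.one_notMem_cone h)
    (by
      intro g hg
      by_cases h : φ g = 1
      · exact (P.mem_cone_or_inv_mem hg).imp (fun h' => Or.inr ⟨h, h'⟩)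
          fun h' => Or.inr ⟨by rw [map_inv, h, inv_one], h'⟩
      · exact (Q.mem_cone_or_inv_mem h).imp Or.inl fun h' => Or.inl (by rwa [map_inv]))

theorem mem_lex_cone (φ : G →* H) (Q : LO H) (P : LO G) (g : G) :
    g ∈ (lex φ Q P).cone ↔ φ g ∈ Q.cone ∨ φ g = 1 ∧ g ∈ P.cone :=
  Iff.rfl

/-- The kernel of `φ` is normal and `P` is conjugation invariant, so conjugation is felt only
through `Q`. -/
theorem smul_lex (φ : G →* H) (Q : LO H) {P : LO G} (hP : ∀ g : G, g • P = P) (g : G) :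
    g • lex φ Q P = lex φ (φ g • Q) P := by
  ext h
  have h1 : g⁻¹ * h * g ∈ P.cone ↔ h ∈ P.cone := by rw [← mem_smul_cone, hP]
  have h2 : φ (g⁻¹ * h * g) = 1 ↔ φ h = 1 := by
    rw [← conj_eq_one_iff (a := (φ g)⁻¹) (b := φ h), map_mul, map_mul, map_inv, inv_inv]
  rw [mem_smul_cone, mem_lex_cone, mem_lex_cone, mem_smul_cone, h1, h2, map_mul, map_mul, map_inv]

/-- A family of left-orderings is continuous if the positivity of each element depends continuously
on the parameter. -/
theorem continuous_of_isClopen {X : Type*} [TopologicalSpace X] {f : X → LO G}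
    (h : ∀ g, IsClopen {x | g ∈ (f x).cone}) : Continuous f := by
  refine continuous_induced_rng.2 (continuous_pi fun g => (continuous_bool_rng true).2 ?_)
  convert h g
  ext x
  simp [indicator]

end LO

/-- The bi-ordering of a free group by the Magnus expansion. -/
def magnusOrder (ι : Type*) [DecidableEq ι] [Encodable ι] : LO (FreeGroup ι) :=
  LO.ofPos MagnusPos (fun _ _ => MagnusPos.mul) not_magnusPos_one fun _ => magnusPos_or_inv

theorem smul_magnusOrder {ι : Type*} [DecidableEq ι] [Encodable ι] (g : FreeGroup ι) :
    g • magnusOrder ι = magnusOrder ι := by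
  ext h
  rw [LO.mem_smul_cone]
  change MagnusPos _ ↔ MagnusPos _
  exact ⟨fun hh => by simpa [mul_assoc] using hh.conj g, fun hh => by simpa using hh.conj g⁻¹⟩

end LeftOrders

/-! ### Orderings of the wreath product from binary sequences -/

section Wreath

/-- The last nonzero coefficient of `c`, say at `m`, is positive if `x m` is true and negative
otherwise. -/
def TwistedPos (x : ℤ → Bool) (c : ℤ →₀ ℤ) : Prop :=
  ∃ m, (∀ j, m < j → c j = 0) ∧ 0 < boolSign (x m) * c m

theorem not_twistedPos_zero (x : ℤ → Bool) : ¬ TwistedPos x 0 := by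
  rintro ⟨m, -, h⟩
  simp at h

theorem TwistedPos.add {x : ℤ → Bool} {c d : ℤ →₀ ℤ} (hc : TwistedPos x c)
    (hd : TwistedPos x d) : TwistedPos x (c + d) := by
  obtain ⟨m, hm, hm'⟩ := hc
  obtain ⟨n, hn, hn'⟩ := hd
  rcases lt_trichotomy m n with h | rfl | h
  · refine ⟨n, fun j hj => ?_, ?_⟩
    · rw [Finsupp.add_apply, hm j (h.trans hj), hn j hj, add_zero]
    · rwa [Finsupp.add_apply, hm n h, zero_add]
  · refine ⟨m, fun j hj => ?_, ?_⟩
    · rw [Finsupp.add_apply, hm j hj, hn j hj, add_zero]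
    · rw [Finsupp.add_apply, mul_add]
      exact add_pos hm' hn'
  · refine ⟨m, fun j hj => ?_, ?_⟩
    · rw [Finsupp.add_apply, hm j hj, hn j (h.trans hj), add_zero]
    · rwa [Finsupp.add_apply, hn m h, add_zero]

theorem twistedPos_or_neg (x : ℤ → Bool) {c : ℤ →₀ ℤ} (hc : c ≠ 0) :
    TwistedPos x c ∨ TwistedPos x (-c) := by
  have hne := Finsupp.support_nonempty_iff.2 hc
  set m := c.support.max' hne with hm
  have hmc : c m ≠ 0 := Finsupp.mem_support_iff.1 (c.support.max'_mem hne)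
  have hz : ∀ j, m < j → c j = 0 := fun j hj => by
    by_contra h
    exact hj.not_ge (c.support.le_max' j (Finsupp.mem_support_iff.2 h))
  have hs : boolSign (x m) * c m ≠ 0 := mul_ne_zero (by cases x m <;> decide) hmc
  rcases hs.lt_or_gt with h | h
  · refine Or.inr ⟨m, fun j hj => by rw [Finsupp.neg_apply, hz j hj, neg_zero], ?_⟩
    rw [Finsupp.neg_apply]
    linarith
  · exact Or.inl ⟨m, hz, h⟩

/-- Positivity of `c` is a union of conditions on single coordinates, hence open; for `c ≠ 0` its
complement is positivity of `-c`. -/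
theorem isClopen_setOf_twistedPos (c : ℤ →₀ ℤ) : IsClopen {x | TwistedPos x c} := by
  by_cases hc : c = 0
  · subst hc
    simp [not_twistedPos_zero, isClopen_empty]
  have hopen (d : ℤ →₀ ℤ) : IsOpen {x | TwistedPos x d} := by
    have : {x | TwistedPos x d} =
        ⋃ m, {x : ℤ → Bool | (∀ j, m < j → d j = 0) ∧ 0 < boolSign (x m) * d m} := by
      ext x
      simp [TwistedPos]
    rw [this]
    refine isOpen_iUnion fun m => ?_
    exact (isOpen_discrete {b : Bool | (∀ j, m < j → d j = 0) ∧ 0 < boolSign b * d m}).preimage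
      (continuous_apply (A := fun _ : ℤ => Bool) m)
  refine ⟨⟨?_⟩, hopen c⟩
  have : {x | TwistedPos x c}ᶜ = {x | TwistedPos x (-c)} := by
    ext x
    refine ⟨(twistedPos_or_neg x hc).resolve_left, fun h h' => not_twistedPos_zero x ?_⟩
    simpa using h'.add h
  rw [this]
  exact hopen _

theorem twistedPos_single_zero_one (x : ℤ → Bool) :
    TwistedPos x (Finsupp.single 0 1) ↔ x 0 = true := by
  constructor
  · rintro ⟨m, -, hm'⟩
    obtain rfl : m = 0 := by
      by_contra h
      simp [Finsupp.single_eq_of_ne h] at hm'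
    cases h : x 0
    · simp [h, boolSign] at hm'
    · rfl
  · intro h
    exact ⟨0, fun j hj => Finsupp.single_eq_of_ne hj.ne', by simp [h, boolSign]⟩

/-- The shift of `ℤ →₀ ℤ`. -/
noncomputable def finsuppShift : (ℤ →₀ ℤ) ≃+ (ℤ →₀ ℤ) := Finsupp.domCongr (Equiv.addRight 1)

theorem finsuppShift_apply (c : ℤ →₀ ℤ) (j : ℤ) : finsuppShift c j = c (j - 1) := by
  simp [finsuppShift, sub_eq_add_neg]

theorem twistedPos_finsuppShift (x : ℤ → Bool) (c : ℤ →₀ ℤ) :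
    TwistedPos (binaryShift x) (finsuppShift c) ↔ TwistedPos x c := by
  constructor
  · rintro ⟨m, hm, hm'⟩
    refine ⟨m - 1, fun j hj => ?_, ?_⟩
    · simpa [finsuppShift_apply] using hm (j + 1) (by omega)
    · rwa [finsuppShift_apply] at hm'
  · rintro ⟨m, hm, hm'⟩
    refine ⟨m + 1, fun j hj => ?_, ?_⟩
    · rw [finsuppShift_apply]
      exact hm _ (by omega)
    · rw [finsuppShift_apply]
      simpa [binaryShift] using hm'

/-- The action of `ℤ` on `ℤ →₀ ℤ` by the shift. -/
noncomputable def shiftAction : Multiplicative ℤ →* MulAut (Multiplicative (ℤ →₀ ℤ)) :=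
  zpowersHom _ (AddEquiv.toMultiplicative finsuppShift)

/-- The restricted wreath product of `ℤ` by `ℤ`. -/
abbrev IntWreath : Type := Multiplicative (ℤ →₀ ℤ) ⋊[shiftAction] Multiplicative ℤ

/-- Positivity in the left-ordering of the wreath product attached to a binary sequence. -/
def WreathPos (x : ℤ → Bool) (h : IntWreath) : Prop :=
  0 < h.right.toAdd ∨ h.right = 1 ∧ TwistedPos x h.left.toAdd

/-- The left-ordering of the wreath product attached to a binary sequence. -/
noncomputable def wreathOrder (x : ℤ → Bool) : LO IntWreath :=
  LO.ofPos (WreathPos x)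
    (by
      rintro g h (hg | ⟨hg, hg'⟩) (hh | ⟨hh, hh'⟩)
      · exact Or.inl (add_pos hg hh)
      · exact Or.inl (by simpa [hh] using hg)
      · exact Or.inl (by simpa [hg] using hh)
      · refine Or.inr ⟨by simp [hg, hh], ?_⟩
        simpa [hg] using hg'.add hh')
    (by
      rintro (h | ⟨-, h⟩)
      · simp at h
      · exact not_twistedPos_zero x h)
    (by
      intro g hg
      rcases lt_trichotomy 0 g.right.toAdd with h | h | h
      · exact Or.inl (Or.inl h)
      · have h1 : g.right = 1 := h.symm
        have h2 : g.left.toAdd ≠ 0 := fun h2 => hg (SemidirectProduct.ext h2 h1)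
        refine (twistedPos_or_neg x h2).imp (fun h3 => Or.inr ⟨h1, h3⟩) fun h3 => Or.inr ⟨?_, ?_⟩
        · simp [h1]
        · simpa [h1] using h3
      · exact Or.inr (Or.inl (by simpa using h)))

/-- Conjugation by this generator fixes the coordinate in the abelian quotient and shifts the base
group, which amounts to shifting `x`. -/
theorem inr_smul_wreathOrder (x : ℤ → Bool) :
    (SemidirectProduct.inr (Multiplicative.ofAdd 1) : IntWreath) • wreathOrder x =
      wreathOrder (binaryShift x) := by
  have h0 (h : IntWreath) (y : ℤ → Bool) : h ∈ (wreathOrder y).cone ↔ WreathPos y h := Iff.rfl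
  ext h
  obtain ⟨g, rfl⟩ : ∃ g : IntWreath, SemidirectProduct.inr (Multiplicative.ofAdd 1) * g *
      (SemidirectProduct.inr (Multiplicative.ofAdd 1))⁻¹ = h :=
    ⟨(SemidirectProduct.inr (Multiplicative.ofAdd 1))⁻¹ * h *
      SemidirectProduct.inr (Multiplicative.ofAdd 1), by simp [mul_assoc]⟩
  have hr : (SemidirectProduct.inr (Multiplicative.ofAdd 1) * g *
      (SemidirectProduct.inr (Multiplicative.ofAdd 1) : IntWreath)⁻¹).right = g.right := by
    simp [mul_comm]
  have hl : (SemidirectProduct.inr (Multiplicative.ofAdd 1) * g *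
      (SemidirectProduct.inr (Multiplicative.ofAdd 1) : IntWreath)⁻¹).left.toAdd =
      finsuppShift g.left.toAdd := by
    simp only [SemidirectProduct.mul_left, SemidirectProduct.inv_left, SemidirectProduct.left_inr]
    simp only [map_inv, inv_one, map_one, mul_one, one_mul]
    change ((AddEquiv.toMultiplicative finsuppShift ^ (1 : ℤ)) g.left).toAdd = _
    rw [zpow_one]
    rfl
  rw [LO.mem_smul_cone, h0, h0, WreathPos, WreathPos, hr, hl, twistedPos_finsuppShift]
  simp [mul_assoc]

end Wreath

/-! ### The equivariant embedding into orderings of the free group -/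

section FreeGroupOrders

variable {ι : Type*} [DecidableEq ι]

/-- The homomorphism of the free group onto the wreath product that maps the generators `a` and `b`
to the two standard generators and kills the others. -/
noncomputable def wreathHom (a b : ι) : FreeGroup ι →* IntWreath :=
  FreeGroup.lift fun i =>
    if i = a then SemidirectProduct.inl (Multiplicative.ofAdd (Finsupp.single 0 1))
    else if i = b then SemidirectProduct.inr (Multiplicative.ofAdd 1) else 1

variable [Encodable ι]

/-- The left-ordering of a free group attached to a binary sequence. -/
noncomputable def freeGroupOrder (a b : ι) (x : ℤ → Bool) : LO (FreeGroup ι) :=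
  LO.lex (wreathHom a b) (wreathOrder x) (magnusOrder ι)

theorem freeGroupOrder_binaryShift {a b : ι} (hab : a ≠ b) (x : ℤ → Bool) :
    freeGroupOrder a b (binaryShift x) = FreeGroup.of b • freeGroupOrder a b x := by
  rw [freeGroupOrder, freeGroupOrder, LO.smul_lex _ _ smul_magnusOrder, wreathHom,
    FreeGroup.lift_apply_of, if_neg hab.symm, if_pos rfl, inr_smul_wreathOrder]

theorem of_mem_freeGroupOrder_cone (a b : ι) (x : ℤ → Bool) :
    FreeGroup.of a ∈ (freeGroupOrder a b x).cone ↔ x 0 = true := by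
  have h1 : wreathHom a b (FreeGroup.of a) =
      SemidirectProduct.inl (Multiplicative.ofAdd (Finsupp.single 0 1)) := by
    simp [wreathHom]
  have h2 : wreathHom a b (FreeGroup.of a) ≠ 1 := by
    rw [h1, ne_eq, ← map_one SemidirectProduct.inl, SemidirectProduct.inl_inj]
    exact fun h => by simpa using DFunLike.congr_fun (congrArg Multiplicative.toAdd h) 0
  rw [freeGroupOrder, LO.mem_lex_cone, or_iff_left fun h => h2 h.1, h1,
    ← twistedPos_single_zero_one]
  change WreathPos _ _ ↔ _
  simp [WreathPos]

/-- The sign of the generator `a` recovers `x 0`; conjugating by powers of `b` brings every other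
coordinate to position zero. -/
theorem freeGroupOrder_injective {a b : ι} (hab : a ≠ b) :
    Function.Injective (freeGroupOrder a b) := by
  intro x y hxy
  ext n
  induction n using Int.induction_on generalizing x y with
  | zero => rw [Bool.eq_iff_iff, ← of_mem_freeGroupOrder_cone a b, hxy, of_mem_freeGroupOrder_cone]
  | succ n ih =>
    refine ih (x := binaryShift.symm x) (y := binaryShift.symm y)
      (smul_left_cancel (FreeGroup.of b) ?_)
    rw [← freeGroupOrder_binaryShift hab, ← freeGroupOrder_binaryShift hab]
    simpa using hxy
  | pred n ih =>
    refine ih (x := binaryShift x) (y := binaryShift y) ?_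
    rw [freeGroupOrder_binaryShift hab, freeGroupOrder_binaryShift hab, hxy]

theorem continuous_freeGroupOrder (a b : ι) : Continuous (freeGroupOrder a b) := by
  refine LO.continuous_of_isClopen fun g => ?_
  change IsClopen {x | (0 < (wreathHom a b g).right.toAdd ∨ (wreathHom a b g).right = 1 ∧
    TwistedPos x (wreathHom a b g).left.toAdd) ∨ wreathHom a b g = 1 ∧ g ∈ (magnusOrder ι).cone}
  have hconst (p : Prop) : IsClopen {_x : ℤ → Bool | p} := by
    by_cases hp : p <;> simp [hp, isClopen_empty, isClopen_univ]
  exact ((hconst _).union ((hconst _).inter (isClopen_setOf_twistedPos _))).union (hconst _)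

end FreeGroupOrders

/-! ### Failure of countable separation -/

theorem LOQuotient.measurable_mk (G : Type*) [Group G] :
    Measurable (Quotient.mk (MulAction.orbitRel G (LO G)) : LO G → LOQuotient G) :=
  fun _ hs => hs

/-- The Borel structure on the conjugacy classes of left-orderings of a countable nonabelian free
group is not countably separated. -/
theorem not_countablySeparated_LOQuotient_freeGroup (ι : Type*) [Countable ι] [Nontrivial ι] :
    ¬ MeasurableSpace.CountablySeparated (LOQuotient (FreeGroup ι)) := by
  classical
  intro _
  have := Encodable.ofCountable ι
  obtain ⟨a, b, hab⟩ := exists_pair_ne ι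
  let q : (ℤ → Bool) → LOQuotient (FreeGroup ι) :=
    fun x => Quotient.mk (MulAction.orbitRel _ _) (freeGroupOrder a b x)
  have hq : Measurable q :=
    (LOQuotient.measurable_mk _).comp (continuous_freeGroupOrder a b).measurable
  obtain ⟨y, hy⟩ := exists_fiber_not_countable binaryShift.continuous binaryShift.isOpenMap
    binaryShift_transitive hq fun x => Quotient.sound (s := MulAction.orbitRel _ _)
      ⟨FreeGroup.of b, (freeGroupOrder_binaryShift hab x).symm⟩
  induction y using Quotient.inductionOn with
  | h P =>
    -- The fibre over the class of `P` is contained in the preimage of a countable orbit under an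
    -- injective map.
    refine hy (((Set.countable_range fun g : FreeGroup ι => g • P).preimage_of_injOn
      (freeGroupOrder_injective hab).injOn).mono fun x hx => ?_)
    exact Quotient.exact (s := MulAction.orbitRel _ _) hx

theorem mainTheorem5 :
    (∀ n : ℕ, 2 ≤ n → ¬ StandardBorelSpace (LOQuotient (FreeGroup (Fin n)))) ∧
      ¬ StandardBorelSpace (LOQuotient (FreeGroup ℕ)) := by
  refine ⟨fun n hn _ => ?_, fun _ => not_countablySeparated_LOQuotient_freeGroup ℕ inferInstance⟩
  have : Nontrivial (Fin n) := Fin.nontrivial_iff_two_le.2 hn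
  exact not_countablySeparated_LOQuotient_freeGroup (Fin n) inferInstance
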